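/- Let $k$ be a field of characteristic different from $2$ and $3$. Let $L$ be a Mal'tsev algebra over $k$, that is, a $k$-vector space with a bilinear bracket such that $[x,x]=0$ and $[J(x,y,z),x]=J(x,y,[x,z])$ for all $x,y,z\in L$, where $J(x,y,z)=[x,[y,z]]+[y,[z,x]]+[z,[x,y]]$. Let $U(L)$ be the quotient of the free unital nonassociative $k$-algebra on the vector space $L$ by the two-sided ideal generated by $xy-yx-[x,y]$, $(x,h,g)+(h,x,g)$ and $(h,x,g)+(h,g,x)$, for $x,y\in L$ and $h,g$ in the free algebra, where $(a,b,c)=(ab)c-a(bc)$. A Hopf quasigroup is a unital, possibly nonassociative $k$-algebra $H$ with unital algebra homomorphisms $\Delta:H\to H\otimes H$ and $\varepsilon:H\to k$ forming a coassociative counital coalgebra, and a linear map $S:H\to H$ such that, writing $\Delta h=h_{(1)}\otimes h_{(2)}$, $$S(h_{(1)})(h_{(2)}g)=\varepsilon(h)g=h_{(1)}(S(h_{(2)})g),\qquad (hS(g_{(1)}))g_{(2)}=h\,\varepsilon(g)=(hg_{(1)})S(g_{(2)})\qquad\text{for all } h,g\in H.$$ **Proposition 4.8.** There is a unique Hopf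 quasigroup structure $(\Delta,\varepsilon,S)$ on the algebra $U(L)$ such that $\Delta x=x\otimes 1+1\otimes x$, $\varepsilon x=0$ and $Sx=-x$ for all $x$ in (the image of) $L$, and such that $S$ is a unital anti-algebra homomorphism, i.e. $S(1)=1$ and $S(uv)=S(v)S(u)$ for all $u,v\in U(L)$. -/

import Mathlib

open scoped TensorProduct

/-- `b` makes `L` a Mal'tsev algebra: `b` is alternating and, with the Jacobian
`J(x,y,z) = [x,[y,z]] + [y,[z,x]] + [z,[x,y]]`, one has `[J(x,y,z),x] = J(x,y,[x,z])`. -/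
structure IsMaltsevBracket {k L : Type*} [CommRing k] [AddCommGroup L] [Module k L]
    (b : L →ₗ[k] L →ₗ[k] L) : Prop where
  self : ∀ x, b x x = 0
  maltsev : ∀ x y z,
    b (b x (b y z) + b y (b z x) + b z (b x y)) x =
      b x (b y (b x z)) + b y (b (b x z) x) + b (b x z) (b x y)

/-- The free unital nonassociative `k`-algebra on the set `X`: its basis is `1` together with all
bracketed words in `X`. -/
abbrev FreeUnitalNonassocAlgebra (k X : Type*) [CommRing k] : Type _ :=
  MonoidAlgebra k (WithOne (FreeMagma X))

/-- The inclusion of the generators in the free unital nonassociative algebra. -/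
noncomputable def FreeUnitalNonassocAlgebra.of (k : Type*) {X : Type*} [CommRing k] (x : X) :
    FreeUnitalNonassocAlgebra k X :=
  MonoidAlgebra.single ((FreeMagma.of x : FreeMagma X) : WithOne (FreeMagma X)) 1

namespace MaltsevEnveloping

open FreeUnitalNonassocAlgebra (of)

/-- The defining relations of the enveloping algebra. The relations `add` and `smul` pass from the
free algebra on the set `L` to the free algebra on the module `L` (that is, on a basis of `L`). -/
inductive Rel {k L : Type*} [CommRing k] [AddCommGroup L] [Module k L] (b : L →ₗ[k] L →ₗ[k] L) :
    FreeUnitalNonassocAlgebra k L → FreeUnitalNonassocAlgebra k L → Prop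
  | add (x y : L) : Rel b (of k (x + y)) (of k x + of k y)
  | smul (c : k) (x : L) : Rel b (of k (c • x)) (c • of k x)
  | commutator (x y : L) : Rel b (of k x * of k y - of k y * of k x) (of k (b x y))
  | left_alternating (x : L) (h g : FreeUnitalNonassocAlgebra k L) :
      Rel b (associator (of k x) h g + associator h (of k x) g) 0
  | right_alternating (x : L) (h g : FreeUnitalNonassocAlgebra k L) :
      Rel b (associator h (of k x) g + associator h g (of k x)) 0

end MaltsevEnveloping

/-- The enveloping algebra `U(L)`: the quotient of the free unital nonassociative algebra by the
two-sided ideal (here: the ring congruence) generated by the defining relations. -/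
abbrev MaltsevEnveloping {k L : Type*} [CommRing k] [AddCommGroup L] [Module k L]
    (b : L →ₗ[k] L →ₗ[k] L) : Type _ :=
  (ringConGen (MaltsevEnveloping.Rel b)).Quotient

noncomputable instance {k L : Type*} [CommRing k] [AddCommGroup L] [Module k L]
    (b : L →ₗ[k] L →ₗ[k] L) : Module k (MaltsevEnveloping b) where
  add_smul r s := Quotient.ind fun a => congrArg Quotient.mk'' (add_smul r s a)
  zero_smul := Quotient.ind fun a => congrArg Quotient.mk'' (zero_smul k a)

/-- The canonical map `L → U(L)`. -/
noncomputable def MaltsevEnveloping.ι {k L : Type*} [CommRing k] [AddCommGroup L] [Module k L]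
    (b : L →ₗ[k] L →ₗ[k] L) (x : L) : MaltsevEnveloping b :=
  (FreeUnitalNonassocAlgebra.of k x : FreeUnitalNonassocAlgebra k L)

/-- A Hopf quasigroup structure on a unital, not necessarily associative, `k`-algebra `H`: a
(coassociative, counital) coalgebra structure whose coproduct and counit are unital algebra
homomorphisms, with a linear map `S` satisfying, in Sweedler notation,
`S(h₁)(h₂ g) = ε(h) g = h₁(S(h₂) g)` and `(h S(g₁)) g₂ = h ε(g) = (h g₁) S(g₂)`. -/
class HopfQuasigroup (k H : Type*) [CommRing k] [NonAssocRing H] [Module k H]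
    [IsScalarTower k H H] [SMulCommClass k H H] extends Coalgebra k H where
  comul_one : comul (1 : H) = 1
  comul_mul : ∀ a b : H, comul (a * b) = comul a * comul b
  counit_one : counit (1 : H) = 1
  counit_mul : ∀ a b : H, counit (a * b) = counit a * counit b
  antipode : H →ₗ[k] H
  antipode_mul_left :
    LinearMap.mul' k H ∘ₗ (LinearMap.mul' k H).lTensor H ∘ₗ
      (TensorProduct.assoc k H H H).toLinearMap ∘ₗ
      (antipode.rTensor H).rTensor H ∘ₗ comul.rTensor H =
    (TensorProduct.lid k H).toLinearMap ∘ₗ counit.rTensor H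
  mul_antipode_left :
    LinearMap.mul' k H ∘ₗ (LinearMap.mul' k H).lTensor H ∘ₗ
      (TensorProduct.assoc k H H H).toLinearMap ∘ₗ
      (antipode.lTensor H).rTensor H ∘ₗ comul.rTensor H =
    (TensorProduct.lid k H).toLinearMap ∘ₗ counit.rTensor H
  antipode_mul_right :
    LinearMap.mul' k H ∘ₗ (LinearMap.mul' k H).rTensor H ∘ₗ
      (TensorProduct.assoc k H H H).symm.toLinearMap ∘ₗ
      (antipode.rTensor H).lTensor H ∘ₗ comul.lTensor H =
    (TensorProduct.rid k H).toLinearMap ∘ₗ counit.lTensor H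
  mul_antipode_right :
    LinearMap.mul' k H ∘ₗ (LinearMap.mul' k H).rTensor H ∘ₗ
      (TensorProduct.assoc k H H H).symm.toLinearMap ∘ₗ
      (antipode.lTensor H).lTensor H ∘ₗ comul.lTensor H =
    (TensorProduct.rid k H).toLinearMap ∘ₗ counit.lTensor H

/-! The maps Δ, ε, S come from the universal property `exists_lift`: x⊗1 + 1⊗x is alternating in
U⊗U, and S is a homomorphism to the opposite algebra. Since L generates U = U(L), the
(anti)multiplicativity of these maps gives uniqueness and reduces the coalgebra axioms to
generators.

The antipode identities need more, as U is not associative. With λ_u left multiplication by u, two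
of them say that λ∘S and λ are convolution inverse in End U; the other two say the same of right
multiplications in (End U)ᵐᵒᵖ. For x in L, λ_{xa+ax} = λ_x λ_a + λ_a λ_x, so either convolution Φ
satisfies Φ(xu+ux) = ±[λ_x, Φ(u)], which vanishes once Φ(u) is scalar. Passing to xu
(`convolution_eq_counit`) is an induction over the spans W_n of right-nested words: if [x, W_n] ⊆
W_n, then Φ(xu-ux) = ε(xu-ux) = 0 by induction, and one divides by 2.

Stability (`commutator_mem_wordFiltration`) rests on the derivations ad_[a,b] - 3[L_a, R_b]
(`innerDerivation_mul`), which preserve the image of L by `six_associator`. The W_n exhaust U by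
`mul_mem_wordFiltration_add`. -/

/-! ### Alternating elements and their multiplication operators -/

/-- The elements `a` whose associators change sign when `a` is moved to an adjacent argument. -/
structure IsAlternating {A : Type*} [NonAssocRing A] (a : A) : Prop where
  left : ∀ h g : A, associator a h g + associator h a g = 0
  right : ∀ h g : A, associator h a g + associator h g a = 0

namespace IsAlternating

variable {A : Type*} [NonAssocRing A] {a b : A}

theorem mul_mul_left (ha : IsAlternating a) (u v : A) :
    a * (u * v) = (a * u) * v + (u * a) * v - u * (a * v) := by
  have h := ha.left u v
  simp only [associator_apply] at h
  rw [← sub_eq_zero, ← neg_eq_zero, ← h]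
  abel

theorem mul_mul_right (ha : IsAlternating a) (u v : A) :
    (u * v) * a = u * (a * v) + u * (v * a) - (u * a) * v := by
  have h := ha.right u v
  simp only [associator_apply] at h
  rw [← sub_eq_zero, ← h]
  abel

end IsAlternating

/-- The operator `ad_[a,b] - 3 [L_a, R_b]`. -/
def innerDerivation {A : Type*} [NonAssocRing A] (a b u : A) : A :=
  (a * b - b * a) * u - u * (a * b - b * a) - (3 : ℤ) • (a * (u * b) - (a * u) * b)

section Inner

variable {A : Type*} [NonAssocRing A] {a b : A}

theorem commutator_mulLeft (ha : IsAlternating a) (hb : IsAlternating b) (u : A) :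
    a * (b * u) - b * (a * u) =
      (a * b - b * a) * u - (2 : ℤ) • (a * (u * b) - (a * u) * b) := by
  have h1 := ha.left b u
  have h2 := hb.right a u
  simp only [associator_apply] at h1 h2
  simp only [sub_mul]
  linear_combination (norm := abel) h1 - (2 : ℤ) • h2

/-- Both sides are associators with a and b in the outer slots; reversing the three arguments takes
three adjacent swaps, each moving a or b. -/
theorem mul_mul_comm_left (ha : IsAlternating a) (hb : IsAlternating b) (u : A) :
    (b * u) * a - b * (u * a) = a * (u * b) - (a * u) * b := by
  have h1 := ha.right b u
  have h2 := hb.right a u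
  have h3 := ha.left b u
  simp only [associator_apply] at h1 h2 h3
  linear_combination (norm := abel) h1 + h2 - h3

theorem commutator_mulRight (ha : IsAlternating a) (u : A) :
    (u * b) * a - (u * a) * b =
      - (u * (a * b - b * a)) - (2 : ℤ) • (a * (u * b) - (a * u) * b) := by
  have h1 := ha.right u b
  have h2 := ha.left u b
  simp only [associator_apply] at h1 h2
  simp only [mul_sub]
  linear_combination (norm := abel) h1 - (2 : ℤ) • h2

theorem innerDerivation_eq (ha : IsAlternating a) (hb : IsAlternating b) (u : A) :
    innerDerivation a b u = (a * (b * u) - b * (a * u)) + ((u * b) * a - (u * a) * b) +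
      (a * (u * b) - (a * u) * b) := by
  rw [commutator_mulLeft ha hb, commutator_mulRight ha, innerDerivation]
  abel

/-- In the form [L_a, L_b] + [R_a, R_b] + [L_a, R_b], both sides expand by the alternating rules;
the terms left over cancel by [R_a, L_b] = [L_a, R_b], applied to u and to v. -/
theorem innerDerivation_mul (ha : IsAlternating a) (hb : IsAlternating b) (u v : A) :
    innerDerivation a b (u * v) = innerDerivation a b u * v + u * innerDerivation a b v := by
  have hu := congrArg (· * v) (mul_mul_comm_left ha hb u)
  have hv := congrArg (u * ·) (mul_mul_comm_left ha hb v)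
  simp only [sub_mul, mul_sub] at hu hv
  simp only [innerDerivation_eq ha hb]
  simp only [ha.mul_mul_left u v, hb.mul_mul_left u v, ha.mul_mul_right u v, hb.mul_mul_right u v,
    mul_add, mul_sub, add_mul, sub_mul]
  simp only [ha.mul_mul_left (b * u) v, ha.mul_mul_left (u * b) v, ha.mul_mul_left u (b * v),
    ha.mul_mul_left u (v * b),
    hb.mul_mul_left (a * u) v, hb.mul_mul_left (u * a) v, hb.mul_mul_left u (a * v),
    ha.mul_mul_right (u * b) v, ha.mul_mul_right u (b * v), ha.mul_mul_right u (v * b),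
    hb.mul_mul_right (u * a) v, hb.mul_mul_right u (a * v), hb.mul_mul_right u (v * a),
    hb.mul_mul_right (a * u) v]
  linear_combination (norm := abel) hu + hv

theorem ad_mul (ha : IsAlternating a) (hb : IsAlternating b) (u : A) :
    a * (b * u) - (b * u) * a = b * (a * u - u * a) + (a * b - b * a) * u -
      (3 : ℤ) • (a * (u * b) - (a * u) * b) := by
  have h1 := commutator_mulLeft ha hb u
  have h2 := mul_mul_comm_left ha hb u
  rw [sub_eq_iff_eq_add] at h1 h2
  rw [h1, h2, mul_sub]
  abel

/-- The Jacobian is the signed sum of the six associators of a, b, c. These agree up to sign even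
for arbitrary c, because every adjacent swap involves a or b. -/
theorem six_associator (ha : IsAlternating a) (hb : IsAlternating b) (c : A) :
    (6 : ℤ) • (a * (c * b) - (a * c) * b) =
      ((a * b - b * a) * c - c * (a * b - b * a)) +
      ((b * c - c * b) * a - a * (b * c - c * b)) +
      ((c * a - a * c) * b - b * (c * a - a * c)) := by
  have e1 : associator a b c = -associator a c b := eq_neg_of_add_eq_zero_left (hb.right a c)
  have e2 : associator b a c = -associator a b c := eq_neg_of_add_eq_zero_right (ha.left b c)
  have e3 : associator b c a = -associator b a c := eq_neg_of_add_eq_zero_right (ha.right b c)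
  have e4 : associator c a b = -associator a c b := eq_neg_of_add_eq_zero_right (ha.left c b)
  have e5 : associator c b a = -associator c a b := eq_neg_of_add_eq_zero_right (ha.right c b)
  have key : ((a * b - b * a) * c - c * (a * b - b * a)) +
      ((b * c - c * b) * a - a * (b * c - c * b)) +
      ((c * a - a * c) * b - b * (c * a - a * c)) =
      associator a b c - associator b a c + associator b c a - associator c b a +
      associator c a b - associator a c b := by
    simp only [associator_apply, mul_sub, sub_mul]
    abel
  rw [key, e5, e4, e3, e2, e1, associator_apply]
  abel

end Inner

/-! ### The filtration by right-nested words -/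

section Filtration

variable {k A : Type*} [Field k] [NonAssocRing A] [Module k A] [IsScalarTower k A A]
  [SMulCommClass k A A]

/-- The span of the right-nested words of length at most `n` in elements of `V`. -/
def wordFiltration (V : Submodule k A) : ℕ → Submodule k A
  | 0 => k ∙ (1 : A)
  | n + 1 => wordFiltration V n ⊔ Submodule.map₂ (LinearMap.mul k A) V (wordFiltration V n)

variable {V : Submodule k A}

theorem wordFiltration_le_succ (n : ℕ) : wordFiltration V n ≤ wordFiltration V (n + 1) :=
  le_sup_left

theorem wordFiltration_mono : Monotone (wordFiltration V) :=
  monotone_nat_of_le_succ wordFiltration_le_succ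

theorem mul_mem_wordFiltration {x u : A} {n : ℕ} (hx : x ∈ V) (hu : u ∈ wordFiltration V n) :
    x * u ∈ wordFiltration V (n + 1) :=
  Submodule.mem_sup_right (Submodule.apply_mem_map₂ (LinearMap.mul k A) hx hu)

theorem wordFiltration_succ_le {n : ℕ} {p : Submodule k A} (h : wordFiltration V n ≤ p)
    (hmul : ∀ x ∈ V, ∀ u ∈ wordFiltration V n, x * u ∈ p) : wordFiltration V (n + 1) ≤ p :=
  sup_le h (Submodule.map₂_le.2 hmul)

variable (k) in
/-- The commutator `u ↦ a u - u a` as a linear map. -/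
def adLinear (a : A) : A →ₗ[k] A := LinearMap.mulLeft k a - LinearMap.mulRight k a

@[simp] theorem adLinear_apply (a u : A) : adLinear k a u = a * u - u * a := rfl

variable (k) in
/-- `innerDerivation` as a linear map. -/
def innerDerivationLinear (a b : A) : A →ₗ[k] A :=
  adLinear k (a * b - b * a) - (3 : ℤ) • (LinearMap.mulLeft k a ∘ₗ LinearMap.mulRight k b -
    LinearMap.mulRight k b ∘ₗ LinearMap.mulLeft k a)

@[simp] theorem innerDerivationLinear_apply (a b u : A) :
    innerDerivationLinear k a b u = innerDerivation a b u := rfl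

variable (h2 : (2 : k) ≠ 0) (h3 : (3 : k) ≠ 0) (hV : ∀ x ∈ V, IsAlternating x)
  (hcomm : ∀ x ∈ V, ∀ y ∈ V, x * y - y * x ∈ V)

omit [IsScalarTower k A A] [SMulCommClass k A A] in
include h2 h3 hV hcomm in
-- Dividing by 6 puts [L_x, R_y] z in V, since six times it is a sum of iterated commutators.
theorem innerDerivation_mem {x y z : A} (hx : x ∈ V) (hy : y ∈ V) (hz : z ∈ V) :
    innerDerivation x y z ∈ V := by
  have h6 : (6 : k) ≠ 0 := by
    rw [show (6 : k) = 2 * 3 by norm_num]; exact mul_ne_zero h2 h3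
  have key := six_associator (hV x hx) (hV y hy) z
  have hmem : (6 : k) • (x * (z * y) - (x * z) * y) ∈ V := by
    have : (6 : k) • (x * (z * y) - (x * z) * y) = (6 : ℤ) • (x * (z * y) - (x * z) * y) := by
      module
    rw [this, key]
    refine V.add_mem (V.add_mem ?_ ?_) ?_ <;>
    exact hcomm _ (hcomm _ ‹_› _ ‹_›) _ ‹_›
  have h := V.smul_mem (6 : k)⁻¹ hmem
  rw [inv_smul_smul₀ h6] at h
  exact V.sub_mem (hcomm _ (hcomm _ hx _ hy) _ hz) (V.toAddSubgroup.zsmul_mem h 3)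

include h2 h3 hV hcomm in
theorem innerDerivation_mem_wordFiltration {x y u : A} {n : ℕ} (hx : x ∈ V) (hy : y ∈ V)
    (hu : u ∈ wordFiltration V n) : innerDerivation x y u ∈ wordFiltration V n := by
  suffices h : wordFiltration V n ≤ (wordFiltration V n).comap (innerDerivationLinear k x y) from
    h hu
  induction n generalizing u with
  | zero =>
    refine (Submodule.span_singleton_le_iff_mem _ _).2 ?_
    simp [innerDerivation]
  | succ n ih =>
    refine wordFiltration_succ_le (fun v hv => wordFiltration_le_succ n (ih hv hv)) ?_
    intro z hz v hv
    rw [Submodule.mem_comap, innerDerivationLinear_apply,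
      innerDerivation_mul (hV x hx) (hV y hy)]
    exact add_mem (mul_mem_wordFiltration (innerDerivation_mem h2 h3 hV hcomm hx hy hz) hv)
      (mul_mem_wordFiltration hz (ih hv hv))

include h2 h3 hV hcomm in
theorem commutator_mem_wordFiltration {x u : A} {n : ℕ} (hx : x ∈ V)
    (hu : u ∈ wordFiltration V n) : x * u - u * x ∈ wordFiltration V n := by
  -- The induction hypothesis is needed for x and also for the commutator of x and y.
  suffices h : ∀ x ∈ V, wordFiltration V n ≤ (wordFiltration V n).comap (adLinear k x) from
    h x hx hu
  clear hx hu x u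
  induction n with
  | zero =>
    intro x hx
    refine (Submodule.span_singleton_le_iff_mem _ _).2 ?_
    simp
  | succ n ih =>
    intro x hx
    refine wordFiltration_succ_le (fun v hv => wordFiltration_le_succ n (ih x hx hv)) ?_
    intro y hy v hv
    have hxy := hcomm x hx y hy
    have hd := innerDerivation_mem_wordFiltration h2 h3 hV hcomm hx hy hv
    have h := add_mem (mul_mem_wordFiltration hy (ih x hx hv))
      (wordFiltration_le_succ n hd)
    have hv' := ih _ hxy hv
    rw [Submodule.mem_comap, adLinear_apply] at hv' ⊢
    -- The term -3[L_x, R_y]v is traded for the derivation, which keeps v in its level; the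
    -- remaining v[x,y] is [x,y]v minus a commutator covered by induction.
    have e : x * (y * v) - y * v * x = y * (x * v - v * x) + innerDerivation x y v +
        v * (x * y - y * x) := by
      rw [ad_mul (hV x hx) (hV y hy), innerDerivation]
      abel
    have e2 : v * (x * y - y * x) = (x * y - y * x) * v -
        ((x * y - y * x) * v - v * (x * y - y * x)) := by abel
    rw [e, e2]
    exact add_mem h (sub_mem (mul_mem_wordFiltration hxy hv) (wordFiltration_le_succ n hv'))

include h2 h3 hV hcomm in
theorem mul_mem_wordFiltration_add {u v : A} {m n : ℕ} (hu : u ∈ wordFiltration V m)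
    (hv : v ∈ wordFiltration V n) : u * v ∈ wordFiltration V (m + n) := by
  -- The right factor stays free: the term u(xv) below shortens the left factor while raising the
  -- level of the right one.
  suffices h : ∀ (n : ℕ) (v : A), v ∈ wordFiltration V n →
      wordFiltration V m ≤ (wordFiltration V (m + n)).comap (LinearMap.mulRight k v) from
    h n v hv hu
  clear hu hv u v n
  induction m with
  | zero =>
    intro n v hv
    refine (Submodule.span_singleton_le_iff_mem _ _).2 ?_
    simpa using hv
  | succ m ih =>
    intro n v hv
    refine wordFiltration_succ_le
      (fun u hu => wordFiltration_mono (by omega) (ih n v hv hu)) ?_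
    intro x hx u hu
    rw [Submodule.mem_comap, LinearMap.mulRight_apply]
    have e : (2 : k) • (x * u * v) = x * (u * v) + u * (x * v) + (x * u - u * x) * v := by
      rw [(hV x hx).mul_mul_left u v, sub_mul, two_smul]
      abel
    have m1 : x * (u * v) ∈ wordFiltration V (m + 1 + n) :=
      wordFiltration_mono (by omega) (mul_mem_wordFiltration hx (ih n v hv hu))
    have m2 : u * (x * v) ∈ wordFiltration V (m + 1 + n) :=
      wordFiltration_mono (show m + (n + 1) ≤ m + 1 + n by omega)
        (ih (n + 1) (x * v) (mul_mem_wordFiltration hx hv) hu)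
    have m3 : (x * u - u * x) * v ∈ wordFiltration V (m + 1 + n) :=
      wordFiltration_mono (by omega)
        (ih n v hv (commutator_mem_wordFiltration h2 h3 hV hcomm hx hu))
    have h := (wordFiltration V (m + 1 + n)).smul_mem (2 : k)⁻¹ (add_mem (add_mem m1 m2) m3)
    rwa [← e, inv_smul_smul₀ h2] at h

/-! ### Convolution inverses -/

/-- Two linear maps into an associative algebra whose values on `x a + a x` are given, up to
opposite signs, by anticommutators are convolution inverse to each other on any algebra that is
generated by primitive alternating elements. -/
theorem convolution_eq_counit {B : Type*} [Ring B] [Algebra k B]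
    (P Q : A →ₗ[k] B) (M : A → B) (s : ℤ)
    (hP1 : P 1 = 1) (hQ1 : Q 1 = 1)
    (hP : ∀ x ∈ V, ∀ a, P (x * a + a * x) = s • (M x * P a + P a * M x))
    (hQ : ∀ x ∈ V, ∀ a, Q (x * a + a * x) = -(s • (M x * Q a + Q a * M x)))
    (Δ : A →ₗ[k] A ⊗[k] A) (ε : A →ₗ[k] k) (hΔ1 : Δ 1 = 1) (hε1 : ε 1 = 1)
    (hΔ : ∀ a b, Δ (a * b) = Δ a * Δ b) (hε : ∀ a b, ε (a * b) = ε a * ε b)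
    (hΔV : ∀ x ∈ V, Δ x = x ⊗ₜ 1 + 1 ⊗ₜ x) (hεV : ∀ x ∈ V, ε x = 0)
    (h2 : (2 : k) ≠ 0)
    (hstable : ∀ n, ∀ x ∈ V, ∀ u ∈ wordFiltration V n, x * u - u * x ∈ wordFiltration V n)
    {n : ℕ} {u : A} (hu : u ∈ wordFiltration V n) :
    TensorProduct.lift ((LinearMap.mul k B).compl₁₂ P Q) (Δ u) = algebraMap k B (ε u) := by
  set Φ := TensorProduct.lift ((LinearMap.mul k B).compl₁₂ P Q) with hΦ
  have hΦt : ∀ a b, Φ (a ⊗ₜ b) = P a * Q b := fun a b => by simp [hΦ]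
  have key : ∀ x ∈ V, ∀ T, Φ ((x ⊗ₜ 1 + 1 ⊗ₜ x) * T + T * (x ⊗ₜ 1 + 1 ⊗ₜ x)) =
      s • (M x * Φ T - Φ T * M x) := by
    intro x hx T
    induction T with
    | zero => simp
    | add T T' h h' =>
      rw [mul_add (x ⊗ₜ[k] (1 : A) + _), add_mul T, add_add_add_comm, map_add, h, h', map_add,
        ← smul_add]
      congr 1
      noncomm_ring
    | tmul a b =>
      have e : (x ⊗ₜ[k] (1 : A) + 1 ⊗ₜ x) * a ⊗ₜ b + a ⊗ₜ b * (x ⊗ₜ 1 + 1 ⊗ₜ x) =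
          (x * a + a * x) ⊗ₜ b + a ⊗ₜ (x * b + b * x) := by
        simp only [add_mul, mul_add, Algebra.TensorProduct.tmul_mul_tmul, one_mul, mul_one,
          TensorProduct.add_tmul, TensorProduct.tmul_add]
        abel
      rw [e, map_add, hΦt, hΦt, hΦt, hP x hx, hQ x hx, mul_neg, smul_mul_assoc, mul_smul_comm,
        ← sub_eq_add_neg, ← smul_sub]
      congr 1
      noncomm_ring
  suffices h : wordFiltration V n ≤ LinearMap.eqLocus (Φ ∘ₗ Δ) (Algebra.linearMap k B ∘ₗ ε) from
    h hu
  clear hu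
  induction n with
  | zero =>
    refine (Submodule.span_singleton_le_iff_mem _ _).2 ?_
    rw [LinearMap.mem_eqLocus]
    simp [hΔ1, hε1, Algebra.TensorProduct.one_def, hΦt, hP1, hQ1]
  | succ n ih =>
    refine wordFiltration_succ_le ih ?_
    intro x hx u hu
    rw [LinearMap.mem_eqLocus]
    have h1 : Φ (Δ u) = algebraMap k B (ε u) := ih hu
    have h3 : Φ (Δ (x * u - u * x)) = algebraMap k B (ε (x * u - u * x)) :=
      ih (hstable n x hx u hu)
    have h4 := key x hx (Δ u)
    -- The commutator vanishes because Φ(Δ u) is a scalar.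
    rw [← hΔV x hx, ← hΔ, ← hΔ, map_add, h1, Algebra.commutes, sub_self, smul_zero] at h4
    rw [map_sub, map_sub, map_sub, hε, hε, hεV x hx, zero_mul, mul_zero, sub_zero, map_zero] at h3
    have h5 : (2 : k) • Φ (Δ (x * u)) = 0 := by
      rw [two_smul]
      nth_rw 2 [sub_eq_zero.1 h3]
      exact h4
    have h6 := (smul_eq_zero_iff_right h2).1 h5
    simp [h6, hε, hεV x hx]

end Filtration

/-! ### The universal property of the enveloping algebra -/

section FreeLift

variable {k L B : Type*} [Field k] [NonAssocRing B] [Module k B] [IsScalarTower k B B]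
  [SMulCommClass k B B]

variable (k) in
/-- The unital homomorphism from the free algebra determined by the images of the generators. -/
noncomputable def freeLift (f : L → B) : FreeUnitalNonassocAlgebra k L →ₙₐ[k] B :=
  MonoidAlgebra.liftMagma k (WithOne.lift (FreeMagma.lift f) : WithOne (FreeMagma L) →* B).toMulHom

theorem freeLift_of (f : L → B) (x : L) :
    freeLift k f (FreeUnitalNonassocAlgebra.of k x) = f x := by
  simp [freeLift, FreeUnitalNonassocAlgebra.of]

theorem freeLift_one (f : L → B) : freeLift k f 1 = 1 := by
  simp [freeLift, MonoidAlgebra.one_def]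

end FreeLift

theorem commutator_neg {A : Type*} [NonAssocRing A] (x y : A) :
    -y * -x - -x * -y = y * x - x * y := by
  simp

theorem IsAlternating.neg {A : Type*} [NonAssocRing A] {a : A} (ha : IsAlternating a) :
    IsAlternating (-a) where
  left h g := by
    have e := congrArg (-·) (ha.left h g)
    simp only [associator_apply, neg_mul, mul_neg, neg_zero] at e ⊢
    rw [← e]; abel
  right h g := by
    have e := congrArg (-·) (ha.right h g)
    simp only [associator_apply, neg_mul, mul_neg, neg_zero] at e ⊢
    rw [← e]; abel

/-- Reversing products reverses the arguments of the associator up to sign, so the two conditions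
trade places. -/
theorem IsAlternating.op {A : Type*} [NonAssocRing A] {a : A} (ha : IsAlternating a) :
    IsAlternating (MulOpposite.op a) where
  left h g := by
    apply MulOpposite.unop_injective
    have e := congrArg (-·) (ha.right g.unop h.unop)
    simp only [associator_apply, neg_zero] at e
    simp only [associator_apply, MulOpposite.unop_add, MulOpposite.unop_sub, MulOpposite.unop_mul,
      MulOpposite.unop_op, MulOpposite.unop_zero]
    rw [← e]; abel
  right h g := by
    apply MulOpposite.unop_injective
    have e := congrArg (-·) (ha.left g.unop h.unop)
    simp only [associator_apply, neg_zero] at e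
    simp only [associator_apply, MulOpposite.unop_add, MulOpposite.unop_sub, MulOpposite.unop_mul,
      MulOpposite.unop_op, MulOpposite.unop_zero]
    rw [← e]; abel

namespace MaltsevEnveloping

variable {k L : Type*} [Field k] [AddCommGroup L] [Module k L] {b : L →ₗ[k] L →ₗ[k] L}

theorem mk_eq {a c : FreeUnitalNonassocAlgebra k L} (h : Rel b a c) :
    (a : MaltsevEnveloping b) = c :=
  (RingCon.eq _).2 (RingConGen.Rel.of _ _ h)

variable (b) in
/-- The canonical map `L → U(L)` as a linear map. -/
noncomputable def ιLinear : L →ₗ[k] MaltsevEnveloping b where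
  toFun := ι b
  map_add' x y := mk_eq (Rel.add x y)
  map_smul' c x := mk_eq (Rel.smul c x)

@[simp] theorem ιLinear_apply (x : L) : ιLinear b x = ι b x := rfl

theorem ι_commutator (x y : L) : ι b x * ι b y - ι b y * ι b x = ι b (b x y) :=
  mk_eq (Rel.commutator x y)

theorem isAlternating_ι (x : L) : IsAlternating (ι b x) where
  left h g := by
    obtain ⟨h, rfl⟩ := RingCon.mk'_surjective _ h
    obtain ⟨g, rfl⟩ := RingCon.mk'_surjective _ g
    exact mk_eq (Rel.left_alternating x h g)
  right h g := by
    obtain ⟨h, rfl⟩ := RingCon.mk'_surjective _ h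
    obtain ⟨g, rfl⟩ := RingCon.mk'_surjective _ g
    exact mk_eq (Rel.right_alternating x h g)

@[elab_as_elim]
theorem induction {p : MaltsevEnveloping b → Prop} (ι : ∀ x, p (ι b x)) (one : p 1)
    (add : ∀ u v, p u → p v → p (u + v)) (smul : ∀ (c : k) u, p u → p (c • u))
    (mul : ∀ u v, p u → p v → p (u * v)) (u : MaltsevEnveloping b) : p u := by
  obtain ⟨u, rfl⟩ := RingCon.mk'_surjective _ u
  have single : ∀ m : WithOne (FreeMagma L),
      p ((MonoidAlgebra.single m (1 : k) : FreeUnitalNonassocAlgebra k L) :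
        MaltsevEnveloping b) := by
    intro m
    refine WithOne.cases_on m one fun m => ?_
    induction m using FreeMagma.recOnMul with
    | ih1 x => exact ι x
    | ih2 x y hx hy =>
      have h := mul _ _ hx hy
      rwa [← RingCon.coe_mul, MonoidAlgebra.single_mul_single, one_mul] at h
  induction u using MonoidAlgebra.induction_linear with
  | zero => simpa using smul 0 1 one
  | add u v hu hv => exact add _ _ hu hv
  | single m c =>
    have h := smul c _ (single m)
    rwa [← RingCon.coe_smul, MonoidAlgebra.smul_single, smul_eq_mul, mul_one] at h

theorem hom_ext {B : Type*} [NonAssocSemiring B] [Module k B] {f g : MaltsevEnveloping b →ₗ[k] B} (hf1 : f 1 = 1) (hg1 : g 1 = 1)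
    (hf : ∀ u v, f (u * v) = f u * f v) (hg : ∀ u v, g (u * v) = g u * g v)
    (h : ∀ x, f (ι b x) = g (ι b x)) : f = g := by
  ext u
  induction u using induction with
  | ι x => exact h x
  | one => rw [hf1, hg1]
  | add u v hu hv => rw [map_add, map_add, hu, hv]
  | smul c u hu => rw [map_smul, map_smul, hu]
  | mul u v hu hv => rw [hf, hg, hu, hv]

section Lift

variable {B : Type*} [NonAssocRing B] [Module k B] [IsScalarTower k B B] [SMulCommClass k B B]

/-- The universal property of `U(L)`. -/
theorem exists_lift (f : L →ₗ[k] B) (hcomm : ∀ x y, f x * f y - f y * f x = f (b x y))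
    (halt : ∀ x, IsAlternating (f x)) :
    ∃ F : MaltsevEnveloping b →ₗ[k] B, F 1 = 1 ∧ (∀ u v, F (u * v) = F u * F v) ∧
      ∀ x, F (ι b x) = f x := by
  let G : FreeUnitalNonassocAlgebra k L →+* B :=
    { freeLift k f with map_one' := freeLift_one f }
  have hG : ∀ x, G (FreeUnitalNonassocAlgebra.of k x) = f x := freeLift_of f
  have hGs : ∀ (c : k) u, G (c • u) = c • G u := (freeLift k f).map_smul
  have hle : ringConGen (Rel b) ≤ RingCon.ker G := by
    rw [RingCon.ringConGen_le]
    intro u v h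
    rw [RingCon.ker_apply]
    cases h with
    | add x y => simp [hG]
    | smul c x => simp [hG, hGs]
    | commutator x y => simp [hG, hcomm]
    | left_alternating x h g => simpa [hG, associator_apply] using (halt x).left (G h) (G g)
    | right_alternating x h g => simpa [hG, associator_apply] using (halt x).right (G h) (G g)
  let F := RingCon.lift _ G hle
  refine ⟨{ F with map_smul' := ?_ }, F.map_one, F.map_mul, hG⟩
  intro c u
  obtain ⟨u, rfl⟩ := RingCon.mk'_surjective _ u
  exact hGs c u

end Lift

/-- On pure tensors an associator containing a⊗1 is an associator in the first factor tensored with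
a product in the second; 1⊗a is symmetric. -/
theorem isAlternating_primitive {A : Type*} [NonAssocRing A] [Module k A] [IsScalarTower k A A]
    [SMulCommClass k A A] {a : A} (ha : IsAlternating a) :
    IsAlternating (a ⊗ₜ[k] (1 : A) + 1 ⊗ₜ a) where
  left h g := by
    induction h with
    | zero => simp [associator_apply]
    | add h h' e e' =>
      have := congrArg₂ (· + ·) e e'
      simp only [associator_apply, add_mul, mul_add, add_zero] at this ⊢
      rw [← this]; abel
    | tmul c d =>
      induction g with
      | zero => simp [associator_apply]
      | add h h' e e' =>
        have := congrArg₂ (· + ·) e e'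
        simp only [associator_apply, add_mul, mul_add, add_zero] at this ⊢
        rw [← this]; abel
      | tmul c' d' =>
        have h1 := congrArg (· ⊗ₜ[k] (d * d')) (ha.left c c')
        have h2 := congrArg ((c * c') ⊗ₜ[k] ·) (ha.left d d')
        have h := congrArg₂ (· + ·) h1 h2
        simp only [associator_apply, TensorProduct.add_tmul, TensorProduct.tmul_add,
          TensorProduct.sub_tmul, TensorProduct.tmul_sub, TensorProduct.zero_tmul,
          TensorProduct.tmul_zero, add_zero] at h
        simp only [associator_apply, add_mul, mul_add, Algebra.TensorProduct.tmul_mul_tmul,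
          one_mul, mul_one]
        rw [← h]; abel
  right h g := by
    induction h with
    | zero => simp [associator_apply]
    | add h h' e e' =>
      have := congrArg₂ (· + ·) e e'
      simp only [associator_apply, add_mul, mul_add, add_zero] at this ⊢
      rw [← this]; abel
    | tmul c d =>
      induction g with
      | zero => simp [associator_apply]
      | add h h' e e' =>
        have := congrArg₂ (· + ·) e e'
        simp only [associator_apply, add_mul, mul_add, add_zero] at this ⊢
        rw [← this]; abel
      | tmul c' d' =>
        have h1 := congrArg (· ⊗ₜ[k] (d * d')) (ha.right c c')
        have h2 := congrArg ((c * c') ⊗ₜ[k] ·) (ha.right d d')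
        have h := congrArg₂ (· + ·) h1 h2
        simp only [associator_apply, TensorProduct.add_tmul, TensorProduct.tmul_add,
          TensorProduct.sub_tmul, TensorProduct.tmul_sub, TensorProduct.zero_tmul,
          TensorProduct.tmul_zero, add_zero] at h
        simp only [associator_apply, add_mul, mul_add, Algebra.TensorProduct.tmul_mul_tmul,
          one_mul, mul_one]
        rw [← h]; abel

theorem exists_comul (b : L →ₗ[k] L →ₗ[k] L) :
    ∃ Δ : MaltsevEnveloping b →ₗ[k] MaltsevEnveloping b ⊗[k] MaltsevEnveloping b,
      Δ 1 = 1 ∧ (∀ u v, Δ (u * v) = Δ u * Δ v) ∧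
      ∀ x, Δ (ι b x) = ι b x ⊗ₜ[k] 1 + 1 ⊗ₜ[k] ι b x := by
  refine exists_lift (b := b)
    (B := MaltsevEnveloping b ⊗[k] MaltsevEnveloping b) ((TensorProduct.mk k (MaltsevEnveloping b) (MaltsevEnveloping b)).flip 1 ∘ₗ ιLinear b +
    TensorProduct.mk k (MaltsevEnveloping b) (MaltsevEnveloping b) 1 ∘ₗ ιLinear b) ?_ fun x => isAlternating_primitive (isAlternating_ι (b := b) x)
  intro x y
  simp only [LinearMap.add_apply, LinearMap.comp_apply, ιLinear_apply, LinearMap.flip_apply,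
    TensorProduct.mk_apply, ← ι_commutator, TensorProduct.sub_tmul, TensorProduct.tmul_sub,
    add_mul, mul_add, Algebra.TensorProduct.tmul_mul_tmul, one_mul, mul_one]
  abel

theorem exists_counit (b : L →ₗ[k] L →ₗ[k] L) :
    ∃ ε : MaltsevEnveloping b →ₗ[k] k, ε 1 = 1 ∧ (∀ u v, ε (u * v) = ε u * ε v) ∧
      ∀ x, ε (ι b x) = 0 :=
  exists_lift (0 : L →ₗ[k] k) (by simp) fun x => ⟨by simp [associator_apply],
    by simp [associator_apply]⟩

theorem exists_antipode (b : L →ₗ[k] L →ₗ[k] L) :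
    ∃ S : MaltsevEnveloping b →ₗ[k] MaltsevEnveloping b, S 1 = 1 ∧
      (∀ u v, S (u * v) = S v * S u) ∧ ∀ x, S (ι b x) = -ι b x := by
  obtain ⟨F, h1, hm, hι⟩ := exists_lift (b := b)
    ((MulOpposite.opLinearEquiv k).toLinearMap ∘ₗ (-ιLinear b)) (by
      intro x y
      apply MulOpposite.unop_injective
      -- Reversal of products supplies the minus sign that the two signs of -x and -y cancel out.
      refine (commutator_neg (ι b x) (ι b y)).trans ?_
      rw [← neg_sub, ι_commutator]
      rfl)
    fun x => (isAlternating_ι x).neg.op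
  refine ⟨(MulOpposite.opLinearEquiv k).symm.toLinearMap ∘ₗ F, ?_, ?_, ?_⟩
  · simp [h1]
  · intro u v; simp [hm]
  · intro x; simp [hι]

theorem commutator_mem_range_ι :
    ∀ x ∈ LinearMap.range (ιLinear b), ∀ y ∈ LinearMap.range (ιLinear b),
      x * y - y * x ∈ LinearMap.range (ιLinear b) := by
  rintro _ ⟨x, rfl⟩ _ ⟨y, rfl⟩
  exact ⟨b x y, (ι_commutator x y).symm⟩

theorem isAlternating_of_mem_range_ι : ∀ x ∈ LinearMap.range (ιLinear b), IsAlternating x := by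
  rintro _ ⟨x, rfl⟩
  exact isAlternating_ι x

theorem exists_mem_wordFiltration (h2 : (2 : k) ≠ 0) (h3 : (3 : k) ≠ 0)
    (u : MaltsevEnveloping b) :
    ∃ n, u ∈ wordFiltration (LinearMap.range (ιLinear b)) n := by
  have one : (1 : MaltsevEnveloping b) ∈ wordFiltration (LinearMap.range (ιLinear b)) 0 :=
    Submodule.mem_span_singleton_self (R := k) _
  induction u using induction with
  | ι x =>
    refine ⟨1, ?_⟩
    have h := mul_mem_wordFiltration (n := 0) (LinearMap.mem_range_self (ιLinear b) x) one
    rwa [mul_one] at h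
  | one => exact ⟨0, one⟩
  | add u v hu hv =>
    obtain ⟨m, hm⟩ := hu
    obtain ⟨n, hn⟩ := hv
    exact ⟨m + n, add_mem (wordFiltration_mono (by omega) hm) (wordFiltration_mono (by omega) hn)⟩
  | smul c u hu =>
    obtain ⟨m, hm⟩ := hu
    exact ⟨m, Submodule.smul_mem _ c hm⟩
  | mul u v hu hv =>
    obtain ⟨m, hm⟩ := hu
    obtain ⟨n, hn⟩ := hv
    exact ⟨m + n, mul_mem_wordFiltration_add h2 h3 isAlternating_of_mem_range_ι
      commutator_mem_range_ι hm hn⟩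

end MaltsevEnveloping

/-! ### Multiplicativity of maps on nonassociative tensor products -/

section MapMul

variable {k A B C : Type*} [CommRing k] [NonAssocSemiring A] [Module k A] [IsScalarTower k A A]
  [SMulCommClass k A A] [NonAssocSemiring B] [Module k B] [IsScalarTower k B B]
  [SMulCommClass k B B] [NonAssocSemiring C] [Module k C] [IsScalarTower k C C]
  [SMulCommClass k C C]

theorem LinearMap.rTensor_map_mul (f : A →ₗ[k] B) (hf : ∀ u v, f (u * v) = f u * f v)
    (s t : A ⊗[k] C) : f.rTensor C (s * t) = f.rTensor C s * f.rTensor C t := by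
  induction s with
  | zero => simp
  | add s s' h h' => rw [add_mul, map_add, map_add, add_mul, h, h']
  | tmul a c =>
    induction t with
    | zero => simp
    | add s s' h h' => rw [mul_add, map_add, map_add, mul_add, h, h']
    | tmul a' c' => simp [hf]

theorem LinearMap.lTensor_map_mul (f : A →ₗ[k] B) (hf : ∀ u v, f (u * v) = f u * f v)
    (s t : C ⊗[k] A) : f.lTensor C (s * t) = f.lTensor C s * f.lTensor C t := by
  induction s with
  | zero => simp
  | add s s' h h' => rw [add_mul, map_add, map_add, add_mul, h, h']
  | tmul a c =>
    induction t with
    | zero => simp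
    | add s s' h h' => rw [mul_add, map_add, map_add, mul_add, h, h']
    | tmul a' c' => simp [hf]

theorem TensorProduct.assoc_map_mul (s t : (A ⊗[k] B) ⊗[k] C) :
    TensorProduct.assoc k A B C (s * t) =
      TensorProduct.assoc k A B C s * TensorProduct.assoc k A B C t := by
  induction s with
  | zero => simp
  | add s s' h h' => rw [add_mul, map_add, map_add, add_mul, h, h']
  | tmul s c =>
    induction s with
    | zero => simp
    | add s s' h h' => rw [add_tmul, add_mul, map_add, map_add, add_mul, h, h']
    | tmul a b =>
      induction t with
      | zero => simp
      | add s s' h h' => rw [mul_add, map_add, map_add, mul_add, h, h']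
      | tmul t c' =>
        induction t with
        | zero => simp
        | add s s' h h' => rw [add_tmul, mul_add, map_add, map_add, mul_add, h, h']
        | tmul a' b' => simp

theorem TensorProduct.coassoc_mul {A : Type*} [NonAssocRing A] [Module k A]
    [IsScalarTower k A A] [SMulCommClass k A A] {Δ : A →ₗ[k] A ⊗[k] A}
    (hΔ : ∀ u v, Δ (u * v) = Δ u * Δ v) {u v : A}
    (hu : TensorProduct.assoc k A A A (Δ.rTensor A (Δ u)) = Δ.lTensor A (Δ u))
    (hv : TensorProduct.assoc k A A A (Δ.rTensor A (Δ v)) = Δ.lTensor A (Δ v)) :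
    TensorProduct.assoc k A A A (Δ.rTensor A (Δ (u * v))) = Δ.lTensor A (Δ (u * v)) := by
  rw [hΔ, LinearMap.rTensor_map_mul Δ hΔ, TensorProduct.assoc_map_mul, hu, hv,
    LinearMap.lTensor_map_mul Δ hΔ]

end MapMul

/-! ### Coalgebra axioms and antipode identities -/

namespace MaltsevEnveloping

variable {k L : Type*} [Field k] [AddCommGroup L] [Module k L] {b : L →ₗ[k] L →ₗ[k] L}

section Coalgebra

variable {Δ : MaltsevEnveloping b →ₗ[k] MaltsevEnveloping b ⊗[k] MaltsevEnveloping b}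
  {ε : MaltsevEnveloping b →ₗ[k] k} {S : MaltsevEnveloping b →ₗ[k] MaltsevEnveloping b}
  (hΔ1 : Δ 1 = 1) (hΔ : ∀ u v, Δ (u * v) = Δ u * Δ v)
  (hΔι : ∀ x, Δ (ι b x) = ι b x ⊗ₜ[k] 1 + 1 ⊗ₜ[k] ι b x)
  (hε1 : ε 1 = 1) (hε : ∀ u v, ε (u * v) = ε u * ε v) (hει : ∀ x, ε (ι b x) = 0)
  (hS1 : S 1 = 1) (hS : ∀ u v, S (u * v) = S v * S u) (hSι : ∀ x, S (ι b x) = -ι b x)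

include hΔ1 hΔ hΔι in
theorem comul_coassoc :
    (TensorProduct.assoc k _ _ _).toLinearMap ∘ₗ Δ.rTensor _ ∘ₗ Δ = Δ.lTensor _ ∘ₗ Δ := by
  refine LinearMap.ext fun u => ?_
  simp only [LinearMap.comp_apply, LinearEquiv.coe_coe]
  induction u using induction with
  | ι x =>
    simp [hΔι, hΔ1, Algebra.TensorProduct.one_def, TensorProduct.add_tmul, TensorProduct.tmul_add,
      add_assoc]
  | one => simp [hΔ1, Algebra.TensorProduct.one_def]
  | add u v hu hv => simp only [map_add, hu, hv]
  | smul c u hu => simp only [map_smul, hu]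
  | mul u v hu hv => exact TensorProduct.coassoc_mul hΔ hu hv

include hΔ1 hΔ hΔι hε1 hε hει in
theorem rTensor_counit_comul : ε.rTensor _ ∘ₗ Δ = TensorProduct.mk k k _ 1 := by
  refine hom_ext (B := k ⊗[k] MaltsevEnveloping b) ?_ ?_ ?_ ?_ ?_
  · simp [hΔ1, hε1, Algebra.TensorProduct.one_def]
  · simp [Algebra.TensorProduct.one_def]
  · intro u v
    simp only [LinearMap.comp_apply, hΔ, LinearMap.rTensor_map_mul ε hε]
  · intro u v
    simp
  · intro x
    simp [hΔι, hε1, hει]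

include hΔ1 hΔ hΔι hε1 hε hει in
theorem lTensor_counit_comul : ε.lTensor _ ∘ₗ Δ = (TensorProduct.mk k _ k).flip 1 := by
  refine hom_ext (B := MaltsevEnveloping b ⊗[k] k) ?_ ?_ ?_ ?_ ?_
  · simp [hΔ1, hε1, Algebra.TensorProduct.one_def]
  · simp [Algebra.TensorProduct.one_def]
  · intro u v
    simp only [LinearMap.comp_apply, hΔ, LinearMap.lTensor_map_mul ε hε]
  · intro u v
    simp
  · intro x
    simp [hΔι, hε1, hει]

variable (h2 : (2 : k) ≠ 0) (h3 : (3 : k) ≠ 0) {B : Type*} [Ring B] [Algebra k B]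
  (P : MaltsevEnveloping b →ₗ[k] B) (hP1 : P 1 = 1)
  (hP : ∀ x a, P (ι b x * a + a * ι b x) = P (ι b x) * P a + P a * P (ι b x))

include hΔ1 hΔ hΔι hε1 hε hει hS1 hS hSι h2 h3 hP1 hP

theorem antipode_convolution (u : MaltsevEnveloping b) :
    TensorProduct.lift ((LinearMap.mul k B).compl₁₂ (P ∘ₗ S) P) (Δ u) = algebraMap k B (ε u) := by
  obtain ⟨n, hn⟩ := exists_mem_wordFiltration h2 h3 u
  -- The sign is -1 because S sends an anticommutator with x to minus the anticommutator of x with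
  -- the image.
  refine convolution_eq_counit (P ∘ₗ S) P P (-1) ?_ hP1 ?_ ?_ Δ ε hΔ1 hε1 hΔ hε ?_ ?_ h2
    (fun n x hx u hu => commutator_mem_wordFiltration h2 h3 isAlternating_of_mem_range_ι
      commutator_mem_range_ι hx hu) hn
  · simp [hS1, hP1]
  · rintro _ ⟨x, rfl⟩ a
    have h := hP x (S a)
    have e : S (ι b x * a + a * ι b x) = -(ι b x * S a + S a * ι b x) := by
      rw [map_add, hS, hS, hSι, neg_add, add_comm]
      congr 1
      · exact neg_mul (α := MaltsevEnveloping b) _ _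
      · exact mul_neg (α := MaltsevEnveloping b) _ _
    rw [ιLinear_apply, LinearMap.comp_apply, e, map_neg, h]
    simp [add_comm]
  · rintro _ ⟨x, rfl⟩ a
    simpa [add_comm] using hP x a
  · rintro _ ⟨x, rfl⟩
    exact hΔι x
  · rintro _ ⟨x, rfl⟩
    exact hει x

theorem convolution_antipode (u : MaltsevEnveloping b) :
    TensorProduct.lift ((LinearMap.mul k B).compl₁₂ P (P ∘ₗ S)) (Δ u) = algebraMap k B (ε u) := by
  obtain ⟨n, hn⟩ := exists_mem_wordFiltration h2 h3 u
  refine convolution_eq_counit P (P ∘ₗ S) P 1 hP1 ?_ ?_ ?_ Δ ε hΔ1 hε1 hΔ hε ?_ ?_ h2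
    (fun n x hx u hu => commutator_mem_wordFiltration h2 h3 isAlternating_of_mem_range_ι
      commutator_mem_range_ι hx hu) hn
  · simp [hS1, hP1]
  · rintro _ ⟨x, rfl⟩ a
    simpa using hP x a
  · rintro _ ⟨x, rfl⟩ a
    have h := hP x (S a)
    have e : S (ι b x * a + a * ι b x) = -(ι b x * S a + S a * ι b x) := by
      rw [map_add, hS, hS, hSι, neg_add, add_comm]
      congr 1
      · exact neg_mul (α := MaltsevEnveloping b) _ _
      · exact mul_neg (α := MaltsevEnveloping b) _ _
    rw [ιLinear_apply, LinearMap.comp_apply, e, map_neg, h]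
    simp
  · rintro _ ⟨x, rfl⟩
    exact hΔι x
  · rintro _ ⟨x, rfl⟩
    exact hει x

end Coalgebra

variable (b) in
/-- Left multiplication as a linear map into the endomorphism algebra. -/
noncomputable def leftMul : MaltsevEnveloping b →ₗ[k] Module.End k (MaltsevEnveloping b) :=
  LinearMap.mul k (MaltsevEnveloping b)

variable (b) in
/-- Right multiplication as a linear map into the opposite of the endomorphism algebra. -/
noncomputable def rightMul :
    MaltsevEnveloping b →ₗ[k] (Module.End k (MaltsevEnveloping b))ᵐᵒᵖ :=
  (MulOpposite.opLinearEquiv k).toLinearMap ∘ₗ (LinearMap.mul k (MaltsevEnveloping b)).flip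

@[simp] theorem leftMul_apply (u v : MaltsevEnveloping b) : leftMul b u v = u * v := rfl

@[simp] theorem unop_rightMul_apply (u v : MaltsevEnveloping b) :
    (rightMul b u).unop v = v * u := rfl

theorem leftMul_one : leftMul b 1 = 1 := by
  ext v
  simp

theorem rightMul_one : rightMul b 1 = 1 := by
  apply MulOpposite.unop_injective
  ext v
  simp

theorem leftMul_anticommutator (x : L) (a : MaltsevEnveloping b) :
    leftMul b (ι b x * a + a * ι b x) =
      leftMul b (ι b x) * leftMul b a + leftMul b a * leftMul b (ι b x) := by
  ext v
  have h := (isAlternating_ι (b := b) x).mul_mul_left a v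
  simp only [leftMul_apply, LinearMap.add_apply, Module.End.mul_apply, h, add_mul]
  abel

theorem rightMul_anticommutator (x : L) (a : MaltsevEnveloping b) :
    rightMul b (ι b x * a + a * ι b x) =
      rightMul b (ι b x) * rightMul b a + rightMul b a * rightMul b (ι b x) := by
  apply MulOpposite.unop_injective
  ext v
  have h := (isAlternating_ι (b := b) x).mul_mul_right v a
  simp only [unop_rightMul_apply, LinearMap.add_apply, Module.End.mul_apply, MulOpposite.unop_add,
    MulOpposite.unop_mul, h, mul_add]
  abel

/-- Turns the bracketing f(h₁)(g(h₂)v) into composition of operators, so that the convolution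
argument runs in an associative algebra. -/
theorem lift_leftMul_apply (f g : MaltsevEnveloping b →ₗ[k] MaltsevEnveloping b)
    (T : MaltsevEnveloping b ⊗[k] MaltsevEnveloping b) (v : MaltsevEnveloping b) :
    LinearMap.mul' k _ ((LinearMap.mul' k _).lTensor _ (TensorProduct.assoc k _ _ _
      (TensorProduct.map f g T ⊗ₜ[k] v))) =
    TensorProduct.lift ((LinearMap.mul k (Module.End k (MaltsevEnveloping b))).compl₁₂
      (leftMul b ∘ₗ f) (leftMul b ∘ₗ g)) T v := by
  induction T with
  | zero => simp
  | add s t hs ht => simp only [map_add, TensorProduct.add_tmul, LinearMap.add_apply, hs, ht]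
  | tmul c d => simp

theorem lift_rightMul_apply (f g : MaltsevEnveloping b →ₗ[k] MaltsevEnveloping b)
    (T : MaltsevEnveloping b ⊗[k] MaltsevEnveloping b) (v : MaltsevEnveloping b) :
    LinearMap.mul' k _ ((LinearMap.mul' k _).rTensor _ ((TensorProduct.assoc k _ _ _).symm
      (v ⊗ₜ[k] TensorProduct.map f g T))) =
    -- The opposite algebra is used because in (v f(h₁)) g(h₂) the first leg acts first.
    (TensorProduct.lift ((LinearMap.mul k (Module.End k (MaltsevEnveloping b))ᵐᵒᵖ).compl₁₂
      (rightMul b ∘ₗ f) (rightMul b ∘ₗ g)) T).unop v := by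
  induction T with
  | zero => simp
  | add s t hs ht =>
    simp only [map_add, TensorProduct.tmul_add, MulOpposite.unop_add, LinearMap.add_apply, hs, ht]
  | tmul c d => simp

end MaltsevEnveloping

/-! ### Assembly and uniqueness -/

theorem HopfQuasigroup.ext_of_eq {k H : Type*} [CommRing k] [NonAssocRing H] [Module k H]
    [IsScalarTower k H H] [SMulCommClass k H H] {Q R : HopfQuasigroup k H}
    (hΔ : Q.comul = R.comul) (hε : Q.counit = R.counit) (hS : Q.antipode = R.antipode) :
    Q = R := by
  rcases Q with @⟨@⟨@⟨Δ, ε⟩⟩⟩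
  rcases R with @⟨@⟨@⟨Δ', ε'⟩⟩⟩
  cases hΔ
  cases hε
  cases hS
  rfl

theorem proposition4p8 {k L : Type*} [Field k] [AddCommGroup L] [Module k L]
    (h2 : ringChar k ≠ 2) (h3 : ringChar k ≠ 3)
    (b : L →ₗ[k] L →ₗ[k] L) (hb : IsMaltsevBracket b) :
    ∃! Q : HopfQuasigroup k (MaltsevEnveloping b),
      (∀ x : L, Q.comul (MaltsevEnveloping.ι b x) =
        MaltsevEnveloping.ι b x ⊗ₜ[k] 1 + 1 ⊗ₜ[k] MaltsevEnveloping.ι b x) ∧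
      (∀ x : L, Q.counit (MaltsevEnveloping.ι b x) = 0) ∧
      (∀ x : L, Q.antipode (MaltsevEnveloping.ι b x) = -MaltsevEnveloping.ι b x) ∧
      Q.antipode 1 = 1 ∧
      (∀ u v : MaltsevEnveloping b, Q.antipode (u * v) = Q.antipode v * Q.antipode u) := by
  have k2 : (2 : k) ≠ 0 := Ring.two_ne_zero h2
  have k3 : (3 : k) ≠ 0 := by
    intro h
    have hd : ringChar k ∣ 3 := (ringChar.spec k 3).1 (by exact_mod_cast h)
    rcases (Nat.dvd_prime Nat.prime_three).1 hd with h' | h'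
    · exact CharP.ringChar_ne_one h'
    · exact h3 h'
  obtain ⟨Δ, hΔ1, hΔ, hΔι⟩ := MaltsevEnveloping.exists_comul b
  obtain ⟨ε, hε1, hε, hει⟩ := MaltsevEnveloping.exists_counit b
  obtain ⟨S, hS1, hS, hSι⟩ := MaltsevEnveloping.exists_antipode b
  refine ⟨@HopfQuasigroup.mk k (MaltsevEnveloping b) _ _ _ _ _
    { comul := Δ
      counit := ε
      coassoc := MaltsevEnveloping.comul_coassoc hΔ1 hΔ hΔι
      rTensor_counit_comp_comul :=
        MaltsevEnveloping.rTensor_counit_comul hΔ1 hΔ hΔι hε1 hε hει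
      lTensor_counit_comp_comul :=
        MaltsevEnveloping.lTensor_counit_comul hΔ1 hΔ hΔι hε1 hε hει }
    hΔ1 hΔ hε1 hε S ?_ ?_ ?_ ?_, ⟨hΔι, hει, hSι, hS1, hS⟩, ?_⟩
  · refine TensorProduct.ext' fun u v => ?_
    refine (MaltsevEnveloping.lift_leftMul_apply S LinearMap.id (Δ u) v).trans ?_
    rw [LinearMap.comp_id, MaltsevEnveloping.antipode_convolution hΔ1 hΔ hΔι hε1 hε hει hS1 hS
      hSι k2 k3 _ MaltsevEnveloping.leftMul_one MaltsevEnveloping.leftMul_anticommutator]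
    simp
    rfl
  · refine TensorProduct.ext' fun u v => ?_
    refine (MaltsevEnveloping.lift_leftMul_apply LinearMap.id S (Δ u) v).trans ?_
    rw [LinearMap.comp_id, MaltsevEnveloping.convolution_antipode hΔ1 hΔ hΔι hε1 hε hει hS1 hS
      hSι k2 k3 _ MaltsevEnveloping.leftMul_one MaltsevEnveloping.leftMul_anticommutator]
    simp
    rfl
  · refine TensorProduct.ext' fun v u => ?_
    refine (MaltsevEnveloping.lift_rightMul_apply S LinearMap.id (Δ u) v).trans ?_
    have e := MaltsevEnveloping.antipode_convolution hΔ1 hΔ hΔι hε1 hε hει hS1 hS hSι k2 k3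
      (B := (Module.End k (MaltsevEnveloping b))ᵐᵒᵖ) (MaltsevEnveloping.rightMul b) MaltsevEnveloping.rightMul_one
      MaltsevEnveloping.rightMul_anticommutator u
    exact congrArg (fun T => T.unop v) e
  · refine TensorProduct.ext' fun v u => ?_
    refine (MaltsevEnveloping.lift_rightMul_apply LinearMap.id S (Δ u) v).trans ?_
    have e := MaltsevEnveloping.convolution_antipode hΔ1 hΔ hΔι hε1 hε hει hS1 hS hSι k2 k3
      (B := (Module.End k (MaltsevEnveloping b))ᵐᵒᵖ) (MaltsevEnveloping.rightMul b) MaltsevEnveloping.rightMul_one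
      MaltsevEnveloping.rightMul_anticommutator u
    exact congrArg (fun T => T.unop v) e
  · rintro R ⟨hRΔ, hRε, hRS, hRS1, hRSm⟩
    refine HopfQuasigroup.ext_of_eq ?_ ?_ ?_
    · exact MaltsevEnveloping.hom_ext (B := MaltsevEnveloping b ⊗[k] MaltsevEnveloping b)
        R.comul_one hΔ1 R.comul_mul hΔ
        fun x => (hRΔ x).trans (hΔι x).symm
    · exact MaltsevEnveloping.hom_ext (B := k) R.counit_one hε1 R.counit_mul hε
        fun x => (hRε x).trans (hει x).symm
    · ext u
      induction u using MaltsevEnveloping.induction with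
      | ι x => exact (hRS x).trans (hSι x).symm
      | one => exact hRS1.trans hS1.symm
      | add u v hu hv => exact (map_add _ u v).trans ((congrArg₂ _ hu hv).trans (map_add S u v).symm)
      | smul c u hu => exact (map_smul _ c u).trans ((congrArg _ hu).trans (map_smul S c u).symm)
      | mul u v hu hv => exact (hRSm u v).trans ((congrArg₂ _ hv hu).trans (hS u v).symm)
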